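/- Let $X$ be a connected, locally path connected, separable metric space and let $x\in X$. For an open cover $\mathcal U$ of $X$, let $\pi(\mathcal U,x)\le\pi_1(X,x)$ be the subgroup of all finite products of classes of the form $[\alpha*\beta*\alpha^{-1}]$, where $\alpha$ is a path in $X$ starting at $x$ and $\beta$ is a loop based at the end point of $\alpha$ and contained in some member of $\mathcal U$. Let $\pi_1^{sp}(X,x)=\bigcap_{\mathcal U}\pi(\mathcal U,x)$, the intersection over all open covers of $X$ (the Spanier group); it is a normal subgroup of $\pi_1(X,x)$. If the quotient group $\pi_1(X,x)/\pi_1^{sp}(X,x)$ is a free group (of any rank), then $X$ has a categorical universal covering: there is a covering map $p:\widetilde X\to X$ with $\widetilde X$ path connected such that for every covering map $q:\widetilde Y\to X$ with $\widetilde Y$ path connected there exists a covering map $f:\widetilde X\to\widetilde Y$ with $q\circ f=p$, and $f$ is unique up to equivalence of coverings of $\widetilde Y$ (if $f,g$ are two such maps, then $g=f\circ h$ for some homeomorphism $h$ of $\widetilde X$). -/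

import Mathlib

/-- `𝒰` is a cover of `X` by open subsets. -/
def IsOpenCovering {X : Type*} [TopologicalSpace X] (𝒰 : Set (Set X)) : Prop :=
  (∀ U ∈ 𝒰, IsOpen U) ∧ ⋃₀ 𝒰 = Set.univ

/-- The classes in `π₁(X, x)` of the loops `α * β * α⁻¹`, where `α` is a path starting at `x`
and `β` is a loop at the end point of `α` lying inside one of the members of `𝒰`. -/
def spanierGenerators {X : Type*} [TopologicalSpace X] (𝒰 : Set (Set X)) (x : X) :
    Set (FundamentalGroup X x) :=
  {g | ∃ (y : X) (α : Path x y) (β : Path y y) (U : Set X), U ∈ 𝒰 ∧ Set.range β ⊆ U ∧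
    g = FundamentalGroup.fromPath (Path.Homotopic.Quotient.mk ((α.trans β).trans α.symm))}

/-- The Spanier group `π(𝒰, x)` of `X` with respect to `𝒰`: the subgroup of `π₁(X, x)` of all
finite products of classes of loops `α * β * α⁻¹` as above. The set of these classes is stable under
inverses (replace `β` by `β⁻¹`), so the products are exactly the members of the generated
subgroup. -/
noncomputable def coverSpanierGroup {X : Type*} [TopologicalSpace X] (𝒰 : Set (Set X)) (x : X) :
    Subgroup (FundamentalGroup X x) :=
  Subgroup.closure (spanierGenerators 𝒰 x)

/-- The Spanier group `π₁ˢᵖ(X, x)`: the intersection of `π(𝒰, x)` over all open covers `𝒰`. -/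
noncomputable def spanierGroup (X : Type*) [TopologicalSpace X] (x : X) : Subgroup (FundamentalGroup X x) :=
  ⨅ (𝒰 : Set (Set X)) (_ : IsOpenCovering 𝒰), coverSpanierGroup 𝒰 x

theorem spanierGenerators_conj {X : Type*} [TopologicalSpace X] {𝒰 : Set (Set X)} {x : X}
    {g : FundamentalGroup X x} (hg : g ∈ spanierGenerators 𝒰 x) (h : FundamentalGroup X x) :
    h * g * h⁻¹ ∈ spanierGenerators 𝒰 x := by
  obtain ⟨y, α, β, U, hU, hβ, rfl⟩ := hg
  obtain ⟨γ, hγ⟩ := Path.Homotopic.Quotient.mk_surjective (FundamentalGroup.toPath h)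
  obtain rfl : FundamentalGroup.fromPath (Path.Homotopic.Quotient.mk γ) = h := hγ
  refine ⟨y, γ.symm.trans α, β, U, hU, hβ, ?_⟩
  rw [Path.trans_symm, Path.symm_symm]
  simp only [FundamentalGroup.mul_def, FundamentalGroup.inv_def,
    Path.Homotopic.Quotient.mk_trans, Path.Homotopic.Quotient.mk_symm,
    Path.Homotopic.Quotient.trans_assoc]

instance coverSpanierGroup_normal {X : Type*} [TopologicalSpace X] (𝒰 : Set (Set X)) (x : X) :
    (coverSpanierGroup 𝒰 x).Normal := by
  have key : coverSpanierGroup 𝒰 x = Subgroup.normalClosure (spanierGenerators 𝒰 x) := by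
    refine le_antisymm Subgroup.closure_le_normalClosure ?_
    refine (Subgroup.closure_le _).2 fun g hg => ?_
    obtain ⟨a, ha, hag⟩ := Group.mem_conjugatesOfSet_iff.1 hg
    obtain ⟨c, rfl⟩ := isConj_iff.1 hag
    exact Subgroup.subset_closure (spanierGenerators_conj ha c)
  rw [key]
  infer_instance

instance spanierGroup_normal (X : Type*) [TopologicalSpace X] (x : X) :
    (spanierGroup X x).Normal :=
  Subgroup.normal_iInf_normal fun _ => Subgroup.normal_iInf_normal fun _ => inferInstance

universe u v w

/-- A categorical universal covering of `X`: a covering `p : E → X` with `E` path connected such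
that for every covering `q : Y → X` with `Y` path connected there is a covering `f : E → Y` with
`q ∘ f = p`, and any two such `f` are equivalent as coverings of `Y`, that is, they differ by a
homeomorphism of `E`. -/
structure IsCategoricalUniversalCovering {X : Type u} [TopologicalSpace X]
    {E : Type v} [TopologicalSpace E] (p : E → X) : Prop where
  pathConnected : PathConnectedSpace E
  isCovering : IsCoveringMap p
  exists_lift : ∀ (Y : Type w) [TopologicalSpace Y] [PathConnectedSpace Y] (q : Y → X),
    IsCoveringMap q → ∃ f : E → Y, IsCoveringMap f ∧ q ∘ f = p
  unique_lift : ∀ (Y : Type w) [TopologicalSpace Y] [PathConnectedSpace Y] (q : Y → X),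
    IsCoveringMap q → ∀ f g : E → Y, IsCoveringMap f → q ∘ f = p → IsCoveringMap g →
      q ∘ g = p → ∃ h : E ≃ₜ E, g = f ∘ h

/-! Let `c` be the projection of `π₁(X, x)` onto its quotient `G` by the Spanier group. The Spanier
group is an intersection over infinitely many covers; freeness of `G` forces it to contain `π(𝒰, x)`
for a single cover `𝒰`.

Indeed, if arbitrarily small loops `β k` at a point survived in a free group, one could form loops
`ξ k = β k · ξ (k+1) ^ m k` with `m` growing fast. Word length excludes such towers of roots
(`FreeGroup.exists_eq_one_of_tower`), so small loops die at every point
(`exists_pos_forall_loop_map_eq_one`), which gives `𝒰` (`exists_coverSpanierGroup_le_ker`).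

Paths from `x` to the points of small open sets then have locally constant differences in `G`. These
are transition functions of a covering with fibre `G`, whose fundamental group maps into `ker c`,
the Spanier group. Any covering has trivial monodromy along some `π(𝒱, x)`, so the lifting criterion
maps the new covering to it. Uniqueness holds because deck transformations are transitive on fibres.
-/

open Filter Topology unitInterval

/-! ### Word length and roots in free groups -/

namespace FreeGroup

variable {α : Type*} [DecidableEq α]

open reduceCyclically in
theorem norm_pow_succ (g : FreeGroup α) (n : ℕ) :
    norm (g ^ (n + 1)) = 2 * (conjugator g.toWord).length +
      (n + 1) * (reduceCyclically g.toWord).length := by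
  simp [norm, toWord_pow, reduce_flatten_replicate, isReduced_toWord]
  ring

/-- Write `g = u w u⁻¹` with `w` cyclically reduced and nonempty; then `g ^ n` has length `2|u| +
n|w|`. -/
theorem le_norm_pow {g : FreeGroup α} (hg : g ≠ 1) {n : ℕ} (hn : n ≠ 0) :
    n ≤ norm (g ^ n) ∧ norm g ≤ norm (g ^ n) := by
  obtain ⟨n, rfl⟩ := Nat.exists_eq_add_one_of_ne_zero hn
  have h1 := norm_pow_succ g 0
  have hc : 1 ≤ (reduceCyclically g.toWord).length := by
    by_contra! h
    have h0 : reduceCyclically g.toWord = [] := List.eq_nil_of_length_eq_zero (by omega)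
    have := reduceCyclically.conj_conjugator_reduceCyclically g.toWord
    rw [h0, List.append_nil] at this
    apply hg
    rw [← mk_toWord (x := g), ← this, ← mul_mk, ← inv_mk, mul_inv_cancel]
  rw [norm_pow_succ]
  simp only [zero_add, pow_one, one_mul] at h1
  constructor <;> nlinarith

/-- Free groups contain no nontrivial infinite towers of roots of sufficiently fast growing degrees:
this is the algebraic reason for homomorphisms to free groups being continuous. -/
theorem exists_eq_one_of_tower {a b : ℕ → FreeGroup α}
    (h : ∀ k, a k = a (k + 1) ^ (k + 1 + ∑ i ∈ Finset.range (k + 1), norm (b i)) * b k) :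
    ∃ k, b k = 1 := by
  have hpow (k) : norm (a (k + 1) ^ (k + 1 + ∑ i ∈ Finset.range (k + 1), norm (b i))) ≤
      norm (a k) + norm (b k) := by
    rw [eq_mul_inv_of_mul_eq (h k).symm]
    exact (norm_mul_le _ _).trans (by rw [norm_inv_eq])
  have hstep (k) : norm (a (k + 1)) ≤ norm (a k) + norm (b k) := by
    by_cases h1 : a (k + 1) = 1
    · simp [h1]
    · exact (le_norm_pow h1 (by omega)).2.trans (hpow k)
  have hbound (k) : norm (a k) ≤ norm (a 0) + ∑ i ∈ Finset.range k, norm (b i) := by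
    induction k with
    | zero => simp
    | succ k ih => rw [Finset.sum_range_succ]; have := hstep k; omega
  -- Otherwise the power of `a (k + 1)` has length at least its exponent `k + 1 + ∑_{i ≤ k} |b i|`,
  -- but at most `|a k| + |b k| ≤ |a 0| + ∑_{i ≤ k} |b i|`.
  have htriv (k) (hk : norm (a 0) ≤ k) : a (k + 1) = 1 := by
    by_contra h1
    have h2 := (le_norm_pow h1 (n := k + 1 + ∑ i ∈ Finset.range (k + 1), norm (b i)) (by omega)).1
    have h3 := hpow k
    have h4 := hbound k
    rw [Finset.sum_range_succ] at h2 h3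
    omega
  refine ⟨norm (a 0) + 1, ?_⟩
  have := h (norm (a 0) + 1)
  rwa [htriv _ le_rfl, htriv _ (Nat.le_succ _), one_pow, one_mul, eq_comm] at this

end FreeGroup

/-! ### Infinitely nested concatenations -/

namespace Path

variable {X : Type*} [TopologicalSpace X] {x : X}

/-- The `n`-fold concatenation of a loop with itself. -/
noncomputable def iterate (γ : Path x x) : ℕ → Path x x
  | 0 => Path.refl x
  | n + 1 => γ.trans (γ.iterate n)

theorem fromPath_mk_iterate (γ : Path x x) (n : ℕ) :
    FundamentalGroup.fromPath (Homotopic.Quotient.mk (γ.iterate n)) =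
      FundamentalGroup.fromPath (Homotopic.Quotient.mk γ) ^ n := by
  induction n with
  | zero => rfl
  | succ n ih => rw [pow_succ, ← ih]; rfl

/-- The approximations `β k · (β (k + 1) · (⋯) ^ m (k + 1)) ^ m k` of depth `r` to the infinitely
nested concatenation `Path.nested`. -/
noncomputable def nestedApprox (β : ℕ → Path x x) (m : ℕ → ℕ) : ℕ → ℕ → Path x x
  | 0, _ => Path.refl x
  | r + 1, k => (β k).trans ((nestedApprox β m r (k + 1)).iterate (m k))

theorem trans_induction {P : X → X → Prop} {γ γ' δ δ' : Path x x} (h : ∀ t, P (γ t) (γ' t))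
    (h' : ∀ t, P (δ t) (δ' t)) (t : I) : P (γ.trans δ t) (γ'.trans δ' t) := by
  simp only [trans_apply]
  split_ifs
  exacts [h _, h' _]

theorem iterate_induction {P : X → X → Prop} {γ γ' : Path x x} (h : ∀ t, P (γ t) (γ' t)) (n : ℕ)
    (t : I) : P (γ.iterate n t) (γ'.iterate n t) := by
  induction n generalizing t with
  | zero => simpa [iterate] using h 0
  | succ n ih => exact trans_induction h ih t

theorem tendsto_trans {ι : Type*} {l : Filter ι} {γ δ : ι → Path x x} {γ' δ' : Path x x}
    (h : ∀ t, Tendsto (fun i ↦ γ i t) l (𝓝 (γ' t)))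
    (h' : ∀ t, Tendsto (fun i ↦ δ i t) l (𝓝 (δ' t))) (t : I) :
    Tendsto (fun i ↦ (γ i).trans (δ i) t) l (𝓝 (γ'.trans δ' t)) := by
  simp only [trans_apply]
  split_ifs
  exacts [h _, h' _]

theorem tendsto_iterate {ι : Type*} {l : Filter ι} {γ : ι → Path x x} {γ' : Path x x}
    (h : ∀ t, Tendsto (fun i ↦ γ i t) l (𝓝 (γ' t))) (n : ℕ) (t : I) :
    Tendsto (fun i ↦ (γ i).iterate n t) l (𝓝 (γ'.iterate n t)) := by
  induction n generalizing t with
  | zero => exact tendsto_const_nhds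
  | succ n ih => exact tendsto_trans h ih t

variable {β : ℕ → Path x x} {B : ℕ → Set X}

theorem nestedApprox_mem (m : ℕ → ℕ) (hB : Antitone B) (hβ : ∀ k, Set.range (β k) ⊆ B k)
    (r k : ℕ) (t : I) : nestedApprox β m r k t ∈ B k := by
  induction r generalizing k t with
  | zero => simpa [nestedApprox] using hβ k ⟨0, rfl⟩
  | succ r ih =>
    have hk (t : I) : β k t ∈ B k := hβ k ⟨t, rfl⟩
    -- The predicate concerns one path only; the constant paths are dummies.
    exact trans_induction (P := fun v _ ↦ v ∈ B k) hk (δ' := .refl x)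
      (γ' := .refl x) (iterate_induction (P := fun v _ ↦ v ∈ B k) (γ' := .refl x)
      (fun t ↦ hB k.le_succ (ih (k + 1) t)) (m k)) t

/-- Deepening only replaces the innermost constant paths, by loops that lie in `B (k + r)`. -/
theorem nestedApprox_eq_or (m : ℕ → ℕ) (hB : Antitone B) (hβ : ∀ k, Set.range (β k) ⊆ B k)
    {r r' : ℕ} (hr : r ≤ r') (k : ℕ) (t : I) :
    nestedApprox β m r' k t = nestedApprox β m r k t ∨
      nestedApprox β m r k t = x ∧ nestedApprox β m r' k t ∈ B (k + r) := by
  induction r generalizing k t r' with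
  | zero => exact .inr ⟨rfl, nestedApprox_mem m hB hβ r' k t⟩
  | succ r ih =>
    obtain ⟨r', rfl⟩ : ∃ s, r' = s + 1 := ⟨r' - 1, by omega⟩
    refine trans_induction (P := fun v w ↦ v = w ∨ w = x ∧ v ∈ B (k + (r + 1)))
      (fun _ ↦ .inl rfl) (iterate_induction
      (P := fun v w ↦ v = w ∨ w = x ∧ v ∈ B (k + (r + 1))) (fun t ↦ ?_) (m k)) t
    rw [add_comm r, ← add_assoc]
    exact ih (by omega) (k + 1) t

/-- At each parameter the approximations stabilise once they leave `x`, so no completeness is needed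
for the limit. -/
theorem exists_nestedApprox_limit (m : ℕ → ℕ) (hB : Antitone B)
    (hβ : ∀ k, Set.range (β k) ⊆ B k) (k : ℕ) (t : I) :
    ∃ v, ∀ r, nestedApprox β m r k t = v ∨ nestedApprox β m r k t = x ∧ v ∈ B (k + r) := by
  by_cases h : ∀ r, nestedApprox β m r k t = x
  · exact ⟨x, fun r ↦ .inl (h r)⟩
  · push Not at h
    obtain ⟨r₀, h₀⟩ := h
    refine ⟨nestedApprox β m r₀ k t, fun r ↦ ?_⟩
    obtain hr | hr := le_total r r₀
    · exact (nestedApprox_eq_or m hB hβ hr k t).imp_left Eq.symm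
    · exact .inl ((nestedApprox_eq_or m hB hβ hr k t).resolve_right fun h ↦ h₀ h.1)

end Path

/-! ### Small loops die in free groups -/

section Metric

variable {X : Type*} [MetricSpace X] {x : X}

/-- Infinitely nested concatenations of a null sequence of loops in a metric space. -/
theorem exists_nested_concatenation {β : ℕ → Path x x}
    (hβ : ∀ k, Set.range (β k) ⊆ Metric.ball x (1 / (k + 1))) (m : ℕ → ℕ) :
    ∃ ξ : ℕ → Path x x, ∀ k, ξ k = (β k).trans ((ξ (k + 1)).iterate (m k)) := by
  let B : ℕ → Set X := fun k ↦ Metric.ball x (1 / (k + 1))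
  have hB : Antitone B := fun i j hij ↦ Metric.ball_subset_ball (Nat.one_div_le_one_div hij)
  choose v hv using fun k t ↦ Path.exists_nestedApprox_limit (B := B) m hB hβ k t
  have hdist (k r t) : dist (v k t) (Path.nestedApprox β m r k t) < 1 / (r + 1) := by
    obtain h | ⟨h, h'⟩ := hv k t r
    · rw [h, dist_self]; positivity
    · rw [h]; exact hB (Nat.le_add_left r k) h'
  have hunif (k) : TendstoUniformly (fun r t ↦ Path.nestedApprox β m r k t) (v k) atTop := by
    rw [Metric.tendstoUniformly_iff]
    intro ε hε
    obtain ⟨n, hn⟩ := exists_nat_one_div_lt hε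
    filter_upwards [eventually_ge_atTop n] with r hr t
    exact (hdist k r t).trans_le ((Nat.one_div_le_one_div hr).trans hn.le)
  let ξ (k : ℕ) : Path x x :=
    { toFun := v k
      continuous_toFun := (hunif k).continuous (.of_forall fun r ↦ (Path.continuous _))
      source' := tendsto_nhds_unique ((hunif k).tendsto_at 0) (by simp)
      target' := tendsto_nhds_unique ((hunif k).tendsto_at 1) (by simp) }
  refine ⟨ξ, fun k ↦ Path.ext (funext fun t ↦ ?_)⟩
  refine tendsto_nhds_unique ((tendsto_add_atTop_iff_nat 1).2 ((hunif k).tendsto_at t)) ?_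
  exact Path.tendsto_trans (fun _ ↦ tendsto_const_nhds)
    (Path.tendsto_iterate (fun t ↦ (hunif (k + 1)).tendsto_at t) (m k)) t

/-- Homomorphisms from the fundamental group of a metric space to a free group kill all
sufficiently small loops. -/
theorem exists_pos_forall_loop_map_eq_one {α : Type*} (φ : FundamentalGroup X x →* FreeGroup α) :
    ∃ ε > 0, ∀ β : Path x x, Set.range β ⊆ Metric.ball x ε →
      φ (FundamentalGroup.fromPath (Path.Homotopic.Quotient.mk β)) = 1 := by
  classical
  by_contra! h
  choose β hβ hφ using fun k : ℕ ↦ h (1 / (k + 1)) Nat.one_div_pos_of_nat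
  let cl (γ : Path x x) : FreeGroup α :=
    φ (FundamentalGroup.fromPath (Path.Homotopic.Quotient.mk γ))
  -- The exponents involve only the classes of the `β i`, so they are available before `ξ` is built.
  obtain ⟨ξ, hξ⟩ := exists_nested_concatenation hβ fun k ↦
    k + 1 + ∑ i ∈ Finset.range (k + 1), FreeGroup.norm (cl (β i))
  obtain ⟨k, hk⟩ := FreeGroup.exists_eq_one_of_tower (a := fun k ↦ cl (ξ k))
    (b := fun k ↦ cl (β k)) fun k ↦ by
      simp only [cl]
      rw [← map_pow, ← Path.fromPath_mk_iterate, ← map_mul]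
      conv_lhs => rw [hξ k]
      rfl
  exact hφ k hk

end Metric

/-! ### Monodromy and morphisms of coverings -/

namespace IsCoveringMap

variable {E X : Type*} [TopologicalSpace E] [TopologicalSpace X] {p : E → X}
  (cov : IsCoveringMap p)
include cov

theorem locallyPathConnectedSpace [LocallyPathConnectedSpace X] :
    LocallyPathConnectedSpace E := by
  choose φ hφ _ using cov.isLocalHomeomorph
  let _ : ChartedSpace X E :=
    { atlas := Set.range φ
      chartAt := φ
      mem_chart_source := hφ
      chart_mem_atlas := fun e ↦ ⟨e, rfl⟩ }
  exact ChartedSpace.locallyPathConnectedSpace X E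

theorem surjective [PathConnectedSpace X] [Nonempty E] : Function.Surjective p := by
  intro x
  obtain ⟨e⟩ := ‹Nonempty E›
  obtain ⟨Γ, hΓ, -⟩ := cov.exists_path_lifts (PathConnectedSpace.somePath (p e) x) e (by simp)
  exact ⟨Γ 1, by simpa using congr_fun hΓ 1⟩

theorem mem_range_mapOfEq_iff {e : E} {x : X} (he : p e = x) (γ : FundamentalGroup X x) :
    γ ∈ (FundamentalGroup.mapOfEq ⟨p, cov.continuous⟩ he).range ↔
      cov.monodromy γ ⟨e, he⟩ = ⟨e, he⟩ := by
  subst he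
  constructor
  · rintro ⟨Γ, rfl⟩
    rw [FundamentalGroup.mapOfEq_apply]
    exact congr(cov.monodromy $(Path.Homotopic.Quotient.cast_rfl_rfl _) _).trans
      (cov.monodromy_map Γ)
  · intro h
    refine ⟨(cov.liftPathQuotient γ ⟨e, rfl⟩).cast rfl congr($(h.symm).1), ?_⟩
    rw [FundamentalGroup.mapOfEq_apply, Path.Homotopic.Quotient.map_cast,
      cov.map_liftPathQuotient, Path.Homotopic.Quotient.cast_cast]
    exact (Path.Homotopic.Quotient.cast_cast ..).trans (Path.Homotopic.Quotient.cast_rfl_rfl _)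

theorem monodromy_eq_of_lift {x y : X} {γ : Path x y} (Γ : C(I, E)) (h : p ∘ Γ = γ) :
    cov.monodromy (.mk γ) ⟨Γ 0, by simpa using congr_fun h 0⟩ =
      ⟨Γ 1, by simpa using congr_fun h 1⟩ := by
  refine Subtype.ext ?_
  exact congr($((cov.eq_liftPath_iff' (γ := γ) (by simpa using (congr_fun h 0).symm)).2
    ⟨h, rfl⟩) 1).symm

/-- Loops inside small open sets lift to loops. -/
theorem exists_isOpen_monodromy_eq (x : X) :
    ∃ U : Set X, IsOpen U ∧ x ∈ U ∧ ∀ (y : X) (β : Path y y), Set.range β ⊆ U → ∀ e,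
      cov.monodromy (.mk β) e = e := by
  obtain ⟨-, U, hxU, hU, hpU, H, hH⟩ := cov x
  refine ⟨U, hU, hxU, fun y β hβ ⟨e, he⟩ ↦ ?_⟩
  have hmem (t) : β t ∈ U := hβ ⟨t, rfl⟩
  have heU : p e ∈ U := by rw [show p e = y from he, ← β.source]; exact hmem 0
  let Γ : C(I, E) := ⟨fun t ↦ H.symm (⟨β t, hmem t⟩, (H ⟨e, heU⟩).2), by fun_prop⟩
  have hΓ : p ∘ Γ = β := funext fun t ↦ by
    simp only [Γ, Function.comp, ContinuousMap.coe_mk, ← hH, Homeomorph.apply_symm_apply]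
  have hend (t) (ht : β t = y) : Γ t = e := by
    have : (⟨β t, hmem t⟩, (H ⟨e, heU⟩).2) = H ⟨e, heU⟩ :=
      Prod.ext (Subtype.ext (by rw [hH]; exact ht.trans he.symm)) rfl
    simp only [Γ, ContinuousMap.coe_mk, this, Homeomorph.symm_apply_apply]
  have := cov.monodromy_eq_of_lift Γ hΓ
  simpa only [hend 0 β.source, hend 1 β.target] using this

/-- For every covering there is an open cover whose Spanier group acts trivially on the fibers. -/
theorem exists_isOpenCovering_monodromy_eq :
    ∃ 𝒰 : Set (Set X), IsOpenCovering 𝒰 ∧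
      ∀ x, ∀ γ ∈ coverSpanierGroup 𝒰 x, ∀ e, cov.monodromy γ e = e := by
  choose U hU hmem hmono using cov.exists_isOpen_monodromy_eq
  refine ⟨Set.range U, ⟨by simpa [Set.forall_mem_range] using hU, ?_⟩, fun x γ hγ ↦ ?_⟩
  · exact Set.eq_univ_of_forall fun x ↦ ⟨U x, ⟨x, rfl⟩, hmem x⟩
  · suffices coverSpanierGroup (Set.range U) x ≤ (cov.monodromyPerm x).ker by
      intro e
      have := MonoidHom.mem_ker.1 (this hγ)
      rw [← cov.coe_monodromyPerm, this]
      rfl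
    refine (Subgroup.closure_le _).2 ?_
    rintro _ ⟨y, α, β, _, ⟨z, rfl⟩, hβ, rfl⟩
    refine MonoidHom.mem_ker.2 (Equiv.ext fun e ↦ ?_)
    rw [cov.coe_monodromyPerm]
    simp only [Path.Homotopic.Quotient.mk_trans, FundamentalGroup.fromPath,
      FundamentalGroup.fromArrow, Path.Homotopic.Quotient.mk_symm]
    rw [monodromy_trans_apply, monodromy_trans_apply, hmono z y β hβ, ← monodromy_trans_apply,
      Path.Homotopic.Quotient.trans_symm, monodromy_refl]
    rfl

end IsCoveringMap

/-- In the situation of coverings of a locally connected space, morphisms of coverings are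
coverings. -/
theorem IsCoveringMap.of_comp {E Y X : Type*} [TopologicalSpace E] [TopologicalSpace Y]
    [TopologicalSpace X] [LocallyConnectedSpace X] {q : Y → X} {f : E → Y}
    (hq : IsCoveringMap q) (hf : Continuous f) (hqf : IsCoveringMap (q ∘ f)) :
    IsCoveringMap f := by
  intro y
  obtain ⟨hI, U₁, hy₁, hU₁, hqU₁, H₁, hH₁⟩ := hq (q y)
  obtain ⟨hJ, U₂, hy₂, hU₂, hpU₂, H₂, hH₂⟩ := hqf (q y)
  obtain ⟨U, hUsub, hU, hyU, hUc⟩ := locallyConnectedSpace_iff_subsets_isOpen_isConnected.1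
    inferInstance (q y) (U₁ ∩ U₂) ((hU₁.inter hU₂).mem_nhds ⟨hy₁, hy₂⟩)
  have : PreconnectedSpace U := isPreconnected_iff_preconnectedSpace.1 hUc.isPreconnected
  set i₀ := (H₁ ⟨y, hy₁⟩).2
  let g (u : U) (j : q ∘ f ⁻¹' {q y}) : E := H₂.symm (⟨u, (hUsub u.2).2⟩, j)
  have hg (j) : Continuous (g · j) := by fun_prop
  have hqfg (u j) : q (f (g u j)) = u := by
    change (q ∘ f) _ = _
    rw [← hH₂, Homeomorph.apply_symm_apply]
  have hfgU (u j) : q (f (g u j)) ∈ U₁ := by rw [hqfg]; exact (hUsub u.2).1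
  -- `κ j u` is the sheet of `q` into which `f` sends the point over `u` of sheet `j` of `q ∘ f`. It
  -- is constant as `U` is connected, so `f` maps sheets to sheets.
  let κ (j) (u : U) := (H₁ ⟨f (g u j), hfgU u j⟩).2
  have hκ (j) (u u' : U) : κ j u = κ j u' :=
    PreconnectedSpace.constant inferInstance (f := κ j) (by fun_prop)
  let V : Set Y := Subtype.val '' {v : q ⁻¹' U₁ | q v ∈ U ∧ (H₁ v).2 = i₀}
  have hVmem {v : Y} (h : v ∈ V) : ∃ h : q v ∈ U₁, q v ∈ U ∧ (H₁ ⟨v, h⟩).2 = i₀ := by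
    obtain ⟨v, hv, rfl⟩ := h
    exact ⟨v.2, hv⟩
  have hVU {v : Y} (h : v ∈ V) : q v ∈ U := (hVmem h).2.1
  have hV : IsOpen V := by
    refine hqU₁.isOpenMap_subtype_val _ (IsOpen.inter ?_ ?_)
    · exact hU.preimage (hq.continuous.comp continuous_subtype_val)
    · exact (isOpen_discrete {i₀}).preimage (by fun_prop : Continuous fun v ↦ (H₁ v).2)
  let i (e : f ⁻¹' V) : q ∘ f ⁻¹' {q y} := (H₂ ⟨e, (hUsub (hVU e.2)).2⟩).2
  have hgi (e : f ⁻¹' V) : g ⟨q (f e), hVU e.2⟩ (i e) = e := by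
    have : ((⟨q (f e), (hUsub (hVU e.2)).2⟩, i e) : U₂ × _) = H₂ ⟨e, (hUsub (hVU e.2)).2⟩ :=
      Prod.ext (Subtype.ext (hH₂ ⟨e, (hUsub (hVU e.2)).2⟩).symm) rfl
    simp only [g, this, Homeomorph.symm_apply_apply]
  have hi (e : f ⁻¹' V) : κ (i e) ⟨q y, hyU⟩ = i₀ := by
    rw [hκ _ _ ⟨q (f e), hVU e.2⟩]
    simp only [κ, hgi]
    exact (hVmem e.2).2.2
  have hfg (v : V) (j) (hj : κ j ⟨q y, hyU⟩ = i₀) : f (g ⟨q v, hVU v.2⟩ j) = v := by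
    obtain ⟨h₁, h₂, h₃⟩ := hVmem v.2
    have : H₁ ⟨f (g ⟨q v, hVU v.2⟩ j), hfgU _ _⟩ = H₁ ⟨v, h₁⟩ := by
      refine Prod.ext (Subtype.ext ?_) ?_
      · rw [hH₁, hH₁, hqfg]
      · rw [h₃, ← hj, hκ j _ ⟨q v, hVU v.2⟩]
    exact congr_arg Subtype.val (H₁.injective this)
  suffices IsEvenlyCovered f y {j // κ j ⟨q y, hyU⟩ = i₀} from this.to_isEvenlyCovered_preimage
  refine ⟨inferInstance, V, ?_, hV, hV.preimage hf, ?_⟩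
  · exact ⟨⟨y, hy₁⟩, ⟨hyU, rfl⟩, rfl⟩
  · refine ⟨
      { toFun := fun e ↦ (⟨f e, e.2⟩, ⟨i e, hi e⟩)
        invFun := fun a ↦ ⟨g ⟨q a.1, hVU a.1.2⟩ a.2.1, by
          rw [Set.mem_preimage, hfg a.1 _ a.2.2]; exact a.1.2⟩
        left_inv := fun e ↦ Subtype.ext (hgi e)
        right_inv := fun a ↦ ?_
        continuous_toFun := by fun_prop
        continuous_invFun := ?_ }, fun e ↦ rfl⟩
    · refine Prod.ext (Subtype.ext (hfg a.1 _ a.2.2)) (Subtype.ext ?_)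
      simp only [i, g]
      rw [Subtype.coe_eta, Homeomorph.apply_symm_apply]
    · have := hq.continuous
      fun_prop

/-! ### The covering attached to a homomorphism on the fundamental group -/

section PathDifference

variable {X : Type*} [TopologicalSpace X] {x : X} {G : Type*} [Group G]
  (c : FundamentalGroup X x →* G)

/-- The image under `c` of the loop formed by two paths with common endpoints. -/
noncomputable def pathDiff {z : X} (a b : Path.Homotopic.Quotient x z) : G :=
  c (FundamentalGroup.fromPath (a.trans b.symm))

variable {c} {y z : X} (a b d : Path.Homotopic.Quotient x z)

/-- This is the cocycle identity; the order is reversed because a product in `FundamentalGroup` runs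
through its right factor first. -/
theorem pathDiff_mul : pathDiff c b d * pathDiff c a b = pathDiff c a d := by
  rw [pathDiff, pathDiff, ← map_mul, FundamentalGroup.mul_def, pathDiff]
  congr 1
  change (a.trans b.symm).trans (b.trans d.symm) = a.trans d.symm
  rw [Path.Homotopic.Quotient.trans_assoc, ← Path.Homotopic.Quotient.trans_assoc b.symm,
    Path.Homotopic.Quotient.symm_trans, Path.Homotopic.Quotient.refl_trans]

theorem pathDiff_self : pathDiff c a a = 1 :=
  mul_eq_right.1 (pathDiff_mul a a a)

variable {a b} in
theorem pathDiff_eq_one_symm (h : pathDiff c a b = 1) : pathDiff c b a = 1 := by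
  have := pathDiff_mul (c := c) a b a
  rwa [h, mul_one, pathDiff_self] at this

theorem Path.Homotopic.Quotient.symm_trans_rev {X : Type*} [TopologicalSpace X] {x y z : X}
    (a : Path.Homotopic.Quotient x y) (b : Path.Homotopic.Quotient y z) :
    (a.trans b).symm = b.symm.trans a.symm := by
  induction a using Path.Homotopic.Quotient.ind
  induction b using Path.Homotopic.Quotient.ind
  rw [← mk_trans, ← mk_symm, Path.trans_symm]
  rfl

theorem pathDiff_trans (a b : Path.Homotopic.Quotient x y) (δ : Path.Homotopic.Quotient y z) :
    pathDiff c (a.trans δ) (b.trans δ) = pathDiff c a b := by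
  rw [pathDiff, Path.Homotopic.Quotient.symm_trans_rev, Path.Homotopic.Quotient.trans_assoc,
    ← Path.Homotopic.Quotient.trans_assoc δ, Path.Homotopic.Quotient.trans_symm,
    Path.Homotopic.Quotient.refl_trans, pathDiff]

variable (c) in
/-- An open cover `U i`, together with paths from `x` to the points of `U i`, such that the loops
formed by two such paths and a path in `U i` lie in the kernel of `c`. -/
structure LocalPathSections where
  /-- the members of the open cover -/
  U : X → Set X
  isOpen_U i : IsOpen (U i)
  mem_U i : i ∈ U i
  /-- the paths from `x` to the points of `U i` -/
  s : X → ∀ z, Path.Homotopic.Quotient x z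
  pathDiff_s i z z' (δ : Path z z') (hδ : Set.range δ ⊆ U i) :
    pathDiff c ((s i z).trans (.mk δ)) (s i z') = 1

namespace LocalPathSections

theorem nonempty_of_le_ker [PathConnectedSpace X] [LocallyPathConnectedSpace X] {𝒰 : Set (Set X)}
    (h𝒰 : IsOpenCovering 𝒰) (hc : coverSpanierGroup 𝒰 x ≤ c.ker) :
    Nonempty (LocalPathSections c) := by
  classical
  have hcov (i : X) : ∃ V ∈ 𝒰, i ∈ V := Set.mem_sUnion.1 (h𝒰.2 ▸ Set.mem_univ i)
  choose V hV hiV using hcov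
  let α (i : X) : Path x i := PathConnectedSpace.somePath x i
  let s (i z : X) : Path.Homotopic.Quotient x z :=
    -- The second value is never used: `U i` will be the path component of `i` in `V i`.
    if h : JoinedIn (V i) i z then .mk ((α i).trans h.somePath) else .mk (α z)
  refine ⟨⟨fun i ↦ pathComponentIn (V i) i, fun i ↦ (h𝒰.1 _ (hV i)).pathComponentIn i,
    fun i ↦ mem_pathComponentIn_self (hiV i), s, fun i z z' δ hδ ↦ ?_⟩⟩
  have hz : JoinedIn (V i) i z := by simpa using! hδ ⟨0, rfl⟩
  have hz' : JoinedIn (V i) i z' := by simpa using! hδ ⟨1, rfl⟩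
  refine MonoidHom.mem_ker.1 (hc (Subgroup.subset_closure
    ⟨i, α i, (hz.somePath.trans δ).trans hz'.somePath.symm, V i, hV i, ?_, ?_⟩))
  · rw [Path.trans_range, Path.trans_range, Path.symm_range]
    refine Set.union_subset (Set.union_subset ?_ ?_) ?_
    · rintro _ ⟨t, rfl⟩; exact hz.somePath_mem t
    · exact hδ.trans pathComponentIn_subset
    · rintro _ ⟨t, rfl⟩; exact hz'.somePath_mem t
  · simp only [s, dif_pos hz, dif_pos hz', Path.Homotopic.Quotient.mk_trans,
      Path.Homotopic.Quotient.mk_symm, Path.Homotopic.Quotient.symm_trans_rev,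
      Path.Homotopic.Quotient.trans_assoc]

variable (S : LocalPathSections c)

/-- The transition functions between the local sections. -/
noncomputable def transition (i j z : X) : G := pathDiff c (S.s i z) (S.s j z)

/-- Up to `c`, transport along `δ` preserves both sections, hence their difference. This makes the
transition functions locally constant. -/
theorem transition_eq {i j z z' : X} {δ : Path z z'} (hi : Set.range δ ⊆ S.U i)
    (hj : Set.range δ ⊆ S.U j) : S.transition i j z' = S.transition i j z := by
  rw [transition, ← pathDiff_mul _ ((S.s i z).trans (.mk δ)),
    pathDiff_eq_one_symm (S.pathDiff_s i z z' δ hi), mul_one,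
    ← pathDiff_mul _ ((S.s j z).trans (.mk δ)), S.pathDiff_s j z z' δ hj, one_mul, pathDiff_trans]
  rfl

variable [LocallyPathConnectedSpace X] [TopologicalSpace G] [DiscreteTopology G]

/-- The covering of `X` associated with a homomorphism on the fundamental group, as the bundle with
the given transition functions. -/
noncomputable def core : FiberBundleCore X X G where
  baseSet := S.U
  isOpen_baseSet := S.isOpen_U
  indexAt := id
  mem_baseSet_at := S.mem_U
  coordChange i j z v := S.transition i j z * v
  coordChange_self i z _ v := by rw [transition, pathDiff_self, one_mul]
  continuousOn_coordChange i j := by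
    have hcont : ContinuousOn (S.transition i j) (S.U i ∩ S.U j) := fun z hz ↦ by
      refine (continuousAt_const (y := S.transition i j z)).congr ?_ |>.continuousWithinAt
      filter_upwards [pathComponentIn_mem_nhds
        (((S.isOpen_U i).inter (S.isOpen_U j)).mem_nhds hz)] with z' (hz' : JoinedIn _ z z')
      refine (S.transition_eq (δ := hz'.somePath) ?_ ?_).symm
      · rintro _ ⟨t, rfl⟩; exact (hz'.somePath_mem t).1
      · rintro _ ⟨t, rfl⟩; exact (hz'.somePath_mem t).2
    exact (hcont.comp continuousOn_fst fun a ha ↦ ha.1).mul continuousOn_snd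
  coordChange_comp i j k z _ v := by rw [← mul_assoc, transition, transition, pathDiff_mul]; rfl

theorem isCoveringMap : IsCoveringMap S.core.proj :=
  IsFiberBundle.isCoveringMap (F := G) fun x ↦ ⟨S.core.localTrivAt x, S.mem_U x⟩

/-- The lifts of paths to the covering. -/
theorem exists_lift (f : C(I, X)) (v : G) :
    ∃ Γ : C(I, S.core.TotalSpace), S.core.proj ∘ Γ = f ∧ Γ 0 = ⟨f 0, v⟩ ∧
      Γ 1 = ⟨f 1, pathDiff c ((S.s (f 0) (f 0)).trans (.mk ⟨f, rfl, rfl⟩)) (S.s (f 1) (f 1)) *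
        v⟩ := by
  let γ : Path (f 0) (f 1) := ⟨f, rfl, rfl⟩
  let s₀ := S.s (f 0) (f 0)
  -- `w t i` is the coordinate of the lift at time `t` in chart `i`. For fixed `i` it is locally
  -- constant in `t`; `Γ t` itself is recorded in the chart indexed by `f t`.
  let w (t : I) (i : X) : G := pathDiff c (s₀.trans (.mk (γ.subpath 0 t))) (S.s i (f t)) * v
  let Γ (t : I) : S.core.TotalSpace := ⟨f t, w t (f t)⟩
  have hΓ : Continuous Γ := by
    refine continuous_iff_continuousAt.2 fun t₀ ↦ ?_
    have hU : f ⁻¹' S.U (f t₀) ∈ 𝓝 t₀ :=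
      ((S.isOpen_U _).preimage f.continuous).mem_nhds (S.mem_U _)
    refine ((S.core.localTrivAt (f t₀)).toOpenPartialHomeomorph
      |>.continuousAt_iff_continuousAt_comp_left (f := Γ) hU).2 ?_
    refine f.continuous.continuousAt.prodMk ?_
    refine (continuousAt_const (y := w t₀ (f t₀))).congr ?_
    filter_upwards [(tendsto_const_nhds.uIcc tendsto_id).eventually
      (eventually_smallSets_subset.2 hU)] with t (ht : Set.uIcc t₀ t ⊆ _)
    change w t₀ (f t₀) = S.transition (f t) (f t₀) (f t) * w t (f t)
    have hδ : Set.range (γ.subpath t₀ t) ⊆ S.U (f t₀) := by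
      rw [Path.range_subpath]
      exact Set.image_subset_iff.2 ht
    have hcomp : (Path.Homotopic.Quotient.mk (γ.subpath 0 t)) =
        (Path.Homotopic.Quotient.mk (γ.subpath 0 t₀)).trans (.mk (γ.subpath t₀ t)) :=
      (Path.Homotopic.Quotient.eq.2 ⟨Path.Homotopy.subpathTransSubpath γ 0 t₀ t⟩).symm
    have hs : pathDiff c ((S.s (f t₀) (f t₀)).trans (.mk (γ.subpath t₀ t))) (S.s (f t₀) (f t)) = 1 :=
      S.pathDiff_s _ _ _ _ hδ
    simp only [w, transition]
    rw [← mul_assoc, pathDiff_mul, hcomp, ← Path.Homotopic.Quotient.trans_assoc,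
      ← pathDiff_mul _ ((S.s (f t₀) (f t₀)).trans (.mk (γ.subpath t₀ t))),
      hs, one_mul, pathDiff_trans]
  refine ⟨⟨Γ, hΓ⟩, rfl, ?_, ?_⟩
  · have : w 0 (f 0) = v := by
      simp only [w, Path.subpath_self]
      change pathDiff c (s₀.trans (.refl (f 0))) s₀ * v = v
      rw [Path.Homotopic.Quotient.trans_refl, pathDiff_self, one_mul]
    exact congr_arg (Bundle.TotalSpace.mk (f 0)) this
  · have : w 1 (f 1) = pathDiff c (s₀.trans (.mk γ)) (S.s (f 1) (f 1)) * v := by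
      simp only [w, Path.subpath_zero_one]
      rfl
    exact congr_arg (Bundle.TotalSpace.mk (f 1)) this

theorem monodromy_mk {y z : X} (γ : Path.Homotopic.Quotient y z) (v : G) :
    S.isCoveringMap.monodromy γ ⟨⟨y, v⟩, rfl⟩ =
      ⟨⟨z, pathDiff c ((S.s y y).trans γ) (S.s z z) * v⟩, rfl⟩ := by
  induction γ using Path.Homotopic.Quotient.ind with | mk γ =>
  obtain ⟨f, rfl, rfl⟩ := γ
  obtain ⟨Γ, h, h0, h1⟩ := S.exists_lift f v
  have := S.isCoveringMap.monodromy_eq_of_lift (γ := ⟨f, rfl, rfl⟩) Γ h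
  rw [Subtype.ext_iff] at this ⊢
  simp only [h0, h1] at this
  exact this

theorem pathConnectedSpace (hc : Function.Surjective c) :
    PathConnectedSpace S.core.TotalSpace where
  nonempty := ⟨⟨x, (1 : G)⟩⟩
  joined := by
    rintro ⟨y, v : G⟩ ⟨z, w : G⟩
    obtain ⟨ω, hω⟩ := hc (w * v⁻¹)
    -- Chosen so that monodromy along `γ` is left multiplication by `w * v⁻¹`.
    let γ : Path.Homotopic.Quotient y z := ((S.s y y).symm.trans ω).trans (S.s z z)
    obtain ⟨Γ, -⟩ := Path.Homotopic.Quotient.mk_surjective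
      (S.isCoveringMap.liftPathQuotient γ ⟨⟨y, v⟩, rfl⟩)
    have hγ : pathDiff c ((S.s y y).trans γ) (S.s z z) = w * v⁻¹ := by
      rw [← hω, pathDiff]
      congr 1
      simp only [γ]
      rw [Path.Homotopic.Quotient.trans_assoc, Path.Homotopic.Quotient.trans_assoc,
        Path.Homotopic.Quotient.trans_assoc, Path.Homotopic.Quotient.trans_symm,
        Path.Homotopic.Quotient.trans_refl, ← Path.Homotopic.Quotient.trans_assoc,
        Path.Homotopic.Quotient.trans_symm, Path.Homotopic.Quotient.refl_trans]
    rw [S.monodromy_mk, hγ, inv_mul_cancel_right] at Γ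
    exact ⟨Γ⟩

end LocalPathSections

end PathDifference

/-! ### A single cover suffices for a free quotient -/

section Spanier

variable {X : Type u} [MetricSpace X] {x : X}

/-- Homomorphisms to free groups on the fundamental group of a metric space factor through the
quotient by the Spanier group of some open cover. -/
theorem exists_coverSpanierGroup_le_ker [PathConnectedSpace X] [LocallyPathConnectedSpace X]
    {G : Type*} [Group G] [IsFreeGroup G] (c : FundamentalGroup X x →* G) :
    ∃ 𝒰 : Set (Set X), IsOpenCovering 𝒰 ∧ coverSpanierGroup 𝒰 x ≤ c.ker := by
  let α (y : X) : Path x y := PathConnectedSpace.somePath x y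
  let φ (y : X) : FundamentalGroup X y →* FreeGroup (IsFreeGroup.Generators G) :=
    ((IsFreeGroup.mulEquiv G).symm.toMonoidHom.comp c).comp
      (FundamentalGroup.fundamentalGroupMulEquivOfPath (α y)).symm.toMonoidHom
  choose ε hε hφ using fun y ↦ exists_pos_forall_loop_map_eq_one (φ y)
  have hc (y : X) (β : Path y y) (hβ : Set.range β ⊆ Metric.ball y (ε y)) :
      c ((Path.Homotopic.Quotient.mk (α y)).trans
        ((Path.Homotopic.Quotient.mk β).trans (Path.Homotopic.Quotient.mk (α y)).symm)) = 1 :=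
    (map_eq_one_iff _ (IsFreeGroup.mulEquiv G).symm.injective).1 (hφ y β hβ)
  -- Path components of balls let a loop based at another point be dragged back to the centre `y`
  -- inside the ball.
  refine ⟨Set.range fun y ↦ pathComponentIn (Metric.ball y (ε y)) y, ⟨?_, ?_⟩,
    (Subgroup.closure_le _).2 ?_⟩
  · rintro _ ⟨y, rfl⟩
    exact Metric.isOpen_ball.pathComponentIn y
  · exact Set.eq_univ_of_forall fun y ↦
      ⟨_, ⟨y, rfl⟩, mem_pathComponentIn_self (Metric.mem_ball_self (hε y))⟩
  · rintro _ ⟨z, α', β, _, ⟨y, rfl⟩, hβ, rfl⟩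
    have hz : JoinedIn (Metric.ball y (ε y)) y z := by simpa using! hβ ⟨0, rfl⟩
    have hδ : Set.range hz.somePath ⊆ Metric.ball y (ε y) := by
      rintro _ ⟨t, rfl⟩; exact hz.somePath_mem t
    let a := (Path.Homotopic.Quotient.mk (α y)).trans (Path.Homotopic.Quotient.mk hz.somePath)
    have ha : pathDiff c (a.trans (.mk β)) a = 1 := by
      rw [← hc y ((hz.somePath.trans β).trans hz.somePath.symm), pathDiff]
      · simp only [a, Path.Homotopic.Quotient.symm_trans_rev, Path.Homotopic.Quotient.trans_assoc,
          Path.Homotopic.Quotient.mk_trans, Path.Homotopic.Quotient.mk_symm]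
      · rw [Path.trans_range, Path.trans_range, Path.symm_range]
        exact Set.union_subset (Set.union_subset hδ (hβ.trans pathComponentIn_subset)) hδ
    change pathDiff c ((Path.Homotopic.Quotient.mk α').trans (.mk β)) (.mk α') = 1
    -- Replacing `α'` by `a` only conjugates the value in `G`.
    rw [← pathDiff_mul _ (a.trans (.mk β)), pathDiff_trans, ← pathDiff_mul (a.trans (.mk β)) a, ha,
      mul_one, pathDiff_mul, pathDiff_self]

end Spanier

/-! ### Universal property -/

namespace LocalPathSections

variable {X : Type u} [TopologicalSpace X] [LocallyPathConnectedSpace X] {x : X}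
  {G : Type v} [Group G] [TopologicalSpace G] [DiscreteTopology G] {c : FundamentalGroup X x →* G}
  (S : LocalPathSections c)

theorem monodromy_eq_self_iff {y : X} (γ : Path.Homotopic.Quotient y y) (v : G) :
    S.isCoveringMap.monodromy γ ⟨⟨y, v⟩, rfl⟩ = ⟨⟨y, v⟩, rfl⟩ ↔
      pathDiff c ((S.s y y).trans γ) (S.s y y) = 1 := by
  rw [S.monodromy_mk]
  exact Subtype.ext_iff.trans (Bundle.TotalSpace.mk_inj.trans (mul_eq_right (M := G)))

theorem mem_ker_of_mem_range_map {v : G} {γ : FundamentalGroup X x}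
    (hγ : γ ∈ (FundamentalGroup.map ⟨S.core.proj, S.isCoveringMap.continuous⟩ ⟨x, v⟩).range) :
    γ ∈ c.ker := by
  obtain ⟨Γ, rfl⟩ := hγ
  have := (S.monodromy_eq_self_iff _ v).1 (S.isCoveringMap.monodromy_map Γ)
  let s : FundamentalGroup X x := S.s x x
  rw [pathDiff] at this
  change c (s⁻¹ * (_ * s)) = 1 at this
  rw [map_mul, map_mul, map_inv, inv_mul_eq_one, eq_comm, mul_eq_right] at this
  exact this

/-- Whether a loop lifts to a closed path does not depend on the fibre coordinate `v`, so the
lifting criterion applies in both directions, and unique lifting makes the two lifts inverse. -/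
theorem exists_deck_transformation [PathConnectedSpace S.core.TotalSpace]
    {e e' : S.core.TotalSpace} (h : S.core.proj e' = S.core.proj e) :
    ∃ F : S.core.TotalSpace ≃ₜ S.core.TotalSpace, F e = e' ∧ S.core.proj ∘ F = S.core.proj := by
  have := S.isCoveringMap.locallyPathConnectedSpace
  have cov := S.isCoveringMap
  have hlift {e e' : S.core.TotalSpace} (h : S.core.proj e' = S.core.proj e) :
      ∃ F : C(S.core.TotalSpace, S.core.TotalSpace), F e = e' ∧ S.core.proj ∘ F = S.core.proj := by
    refine (cov.existsUnique_continuousMap_lifts_of_range_le (f := ⟨_, cov.continuous⟩) h ?_).exists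
    obtain ⟨y, v⟩ := e
    obtain ⟨z, w⟩ := e'
    obtain rfl : z = y := h
    rintro _ ⟨Γ, rfl⟩
    rw [cov.mem_range_mapOfEq_iff]
    exact (S.monodromy_eq_self_iff _ w).2
      ((S.monodromy_eq_self_iff _ v).1 (cov.monodromy_map Γ))
  obtain ⟨F, hF, hpF⟩ := hlift h
  obtain ⟨F', hF', hpF'⟩ := hlift h.symm
  have key (F F' : C(S.core.TotalSpace, S.core.TotalSpace)) (e) (h : F' (F e) = e)
      (hF : S.core.proj ∘ F = S.core.proj) (hF' : S.core.proj ∘ F' = S.core.proj) (a) :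
      F' (F a) = a :=
    congr_fun (cov.eq_of_comp_eq (g₁ := F' ∘ F) (g₂ := id) (by fun_prop) continuous_id
      (by rw [← Function.comp_assoc, hF', hF]; rfl) e h) a
  exact ⟨⟨⟨F, F', key F F' e (by rw [hF, hF']) hpF hpF', key F' F e' (by rw [hF', hF]) hpF' hpF⟩,
    F.continuous, F'.continuous⟩, hF, hpF⟩

theorem exists_equivalence [PathConnectedSpace S.core.TotalSpace] {Y : Type w} [TopologicalSpace Y]
    [PathConnectedSpace Y] {q : Y → X} (hq : IsCoveringMap q) {f g : S.core.TotalSpace → Y}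
    (hf : IsCoveringMap f) (hqf : q ∘ f = S.core.proj) (hg : IsCoveringMap g)
    (hqg : q ∘ g = S.core.proj) :
    ∃ h : S.core.TotalSpace ≃ₜ S.core.TotalSpace, g = f ∘ h := by
  obtain ⟨e⟩ : Nonempty S.core.TotalSpace := PathConnectedSpace.nonempty
  obtain ⟨e', he'⟩ := hf.surjective (g e)
  have h : S.core.proj e' = S.core.proj e := by
    rw [← congr_fun hqf e', ← congr_fun hqg e, Function.comp_apply, he', Function.comp_apply]
  obtain ⟨F, hF, hpF⟩ := S.exists_deck_transformation h
  refine ⟨F, hq.eq_of_comp_eq hg.continuous (hf.continuous.comp F.continuous) ?_ e ?_⟩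
  · rw [hqg, ← Function.comp_assoc, hqf, hpF]
  · rw [Function.comp_apply, hF, he']

/-- Loops that lift to closed paths lie in `ker c`, hence in the Spanier group of a cover that acts
trivially on the fibres of `q`. -/
theorem exists_isCoveringMap_lift [PathConnectedSpace X] [PathConnectedSpace S.core.TotalSpace]
    (hc : c.ker ≤ spanierGroup X x) {Y : Type w} [TopologicalSpace Y] [PathConnectedSpace Y]
    {q : Y → X} (hq : IsCoveringMap q) :
    ∃ f : S.core.TotalSpace → Y, IsCoveringMap f ∧ q ∘ f = S.core.proj := by
  have := S.isCoveringMap.locallyPathConnectedSpace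
  obtain ⟨y, hy⟩ := hq.surjective x
  obtain ⟨𝒰, h𝒰, hmono⟩ := hq.exists_isOpenCovering_monodromy_eq
  obtain ⟨F, -, hF⟩ := (hq.existsUnique_continuousMap_lifts_of_range_le
    (f := ⟨S.core.proj, S.isCoveringMap.continuous⟩) (a₀ := ⟨x, (1 : G)⟩) hy fun γ hγ ↦ by
      rw [hq.mem_range_mapOfEq_iff]
      exact hmono x γ (iInf₂_le (α := Subgroup _) 𝒰 h𝒰 (hc (S.mem_ker_of_mem_range_map hγ))) _).exists
  exact ⟨F, hq.of_comp F.continuous (hF ▸ S.isCoveringMap), hF⟩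

end LocalPathSections

theorem mainTheorem8 {X : Type u} [MetricSpace X] [TopologicalSpace.SeparableSpace X]
    [ConnectedSpace X] [LocallyPathConnectedSpace X] (x : X)
    (hfree : IsFreeGroup (FundamentalGroup X x ⧸ spanierGroup X x)) :
    ∃ (E : Type u) (_ : TopologicalSpace E) (p : E → X),
      IsCategoricalUniversalCovering.{u, u, w} p := by
  have : PathConnectedSpace X := .of_locallyPathConnectedSpace
  let c := QuotientGroup.mk' (spanierGroup X x)
  obtain ⟨𝒰, h𝒰, hle⟩ := exists_coverSpanierGroup_le_ker c
  obtain ⟨S⟩ := LocalPathSections.nonempty_of_le_ker h𝒰 hle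
  let _ : TopologicalSpace (FundamentalGroup X x ⧸ spanierGroup X x) := ⊥
  have : DiscreteTopology (FundamentalGroup X x ⧸ spanierGroup X x) := ⟨rfl⟩
  have hE := S.pathConnectedSpace (QuotientGroup.mk'_surjective _)
  exact ⟨S.core.TotalSpace, inferInstance, S.core.proj,
    { pathConnected := hE
      isCovering := S.isCoveringMap
      exists_lift := fun Y _ _ q hq ↦
        S.exists_isCoveringMap_lift (QuotientGroup.ker_mk' _).le hq
      unique_lift := fun Y _ _ q hq f g hf hqf hg hqg ↦
        S.exists_equivalence hq hf hqf hg hqg }⟩
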